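/- Let $(M^n,g)$ be a Riemannian (or, more generally, semi-Riemannian) manifold and $f:(M^n,g)\to(\overline M^{n+1},\overline g)$ an isometric immersion into a semi-Riemannian manifold, all data being smooth. Let $N$ be a smooth unit normal field along $f$, $\epsilon_N=\overline g(N,N)=\pm1$, and let $\mathcal A$ be the Weingarten operator, $\overline\nabla_XN=-df(\mathcal AX)$, regarded as the $(0,2)$-tensor $\mathcal A(Y,Z)=g(\mathcal AY,Z)$; here $\overline\nabla$ is the Levi-Civita connection of $\overline g$. Let $\overline V$ be any smooth vector field on $\overline M$, let $V$ be its tangential part on $M$ (so that $\overline V\circ f-df(V)$ is normal to $M$), which is a smooth vector field on $M$, and put $C=\overline g(\overline V,N)$. Then $$\mathcal L_{\overline V}\,\overline g-\mathcal L_V\,g=-2\,\epsilon_N\,C\,\mathcal A\qquad\text{on } M,$$ that is, for all $p\in M$ and $Y,Z\in T_pM$, $$(\mathcal L_{\overline V}\,\overline g)_{f(p)}(df\,Y,df\,Z)-(\mathcal L_Vg)_p(Y,Z)=-2\,\epsilon_N\,C(p)\,g(\mathcal AY,Z).$$ -/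

import Mathlib

open Bundle FiberBundle
open scoped Manifold ContDiff

noncomputable section

/-- A (smooth) semi-Riemannian metric on a manifold `M`: a smooth, symmetric, nondegenerate
`(0,2)`-tensor field of constant index. Riemannian metrics are those of index `0`. -/
structure SemiRiemannianMetric {E : Type*} [NormedAddCommGroup E] [NormedSpace ℝ E]
    {H : Type*} [TopologicalSpace H] (I : ModelWithCorners ℝ E H)
    (M : Type*) [TopologicalSpace M] [ChartedSpace H M] [IsManifold I ∞ M] where
  /-- The scalar product on each tangent space. -/
  val (x : M) : TangentSpace I x →L[ℝ] TangentSpace I x →L[ℝ] ℝ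
  symm (x : M) (v w : TangentSpace I x) : val x v w = val x w v
  nondegenerate (x : M) (v : TangentSpace I x) (hv : ∀ w, val x v w = 0) : v = 0
  /-- The common dimension of the maximal negative definite subspaces of the tangent spaces. -/
  index : ℕ
  index_eq (x : M) : IsGreatest {k : ℕ | ∃ W : Submodule ℝ (TangentSpace I x),
    Module.finrank ℝ W = k ∧ ∀ w ∈ W, w ≠ 0 → val x w w < 0} index
  contMDiff : ContMDiff I (I.prod 𝓘(ℝ, E →L[ℝ] E →L[ℝ] ℝ)) ∞
    (fun x : M ↦ TotalSpace.mk' (E →L[ℝ] E →L[ℝ] ℝ) x (val x))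

namespace SemiRiemannianMetric

section

variable {E : Type*} [NormedAddCommGroup E] [NormedSpace ℝ E]
  {H : Type*} [TopologicalSpace H] {I : ModelWithCorners ℝ E H}
  {M : Type*} [TopologicalSpace M] [ChartedSpace H M] [IsManifold I ∞ M]
  (g : SemiRiemannianMetric I M)

/-- The function `g(X, Y)` for vector fields `X`, `Y`. -/
def pair (X Y : Π x : M, TangentSpace I x) : M → ℝ := fun x ↦ g.val x (X x) (Y x)

theorem mdifferentiableAt_pair {x : M} {X Y : Π x : M, TangentSpace I x}
    (hX : MDiffAt (T% X) x) (hY : MDiffAt (T% Y) x) :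
    MDifferentiableAt I 𝓘(ℝ) (g.pair X Y) x := by
  have : MDifferentiableAt I (I.prod 𝓘(ℝ))
      (fun m ↦ TotalSpace.mk' ℝ (E := Bundle.Trivial M ℝ) m (g.val m (X m) (Y m))) x := by
    apply MDifferentiableAt.clm_bundle_apply₂ (F₁ := E) (F₂ := E)
    · exact g.contMDiff.mdifferentiableAt (by simp)
    · exact hX
    · exact hY
  simp only [mdifferentiableAt_totalSpace] at this
  exact this.2

theorem pair_add_left (X X' Y : Π x : M, TangentSpace I x) :
    g.pair (X + X') Y = g.pair X Y + g.pair X' Y := by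
  ext x; simp [pair]

theorem pair_add_right (X Y Y' : Π x : M, TangentSpace I x) :
    g.pair X (Y + Y') = g.pair X Y + g.pair X Y' := by
  ext x; simp [pair]

theorem pair_smul_left (f : M → ℝ) (X Y : Π x : M, TangentSpace I x) :
    g.pair (f • X) Y = f * g.pair X Y := by
  ext x; simp [pair]

theorem pair_smul_right (f : M → ℝ) (X Y : Π x : M, TangentSpace I x) :
    g.pair X (f • Y) = f * g.pair X Y := by
  ext x; simp [pair]

theorem pair_comm (X Y : Π x : M, TangentSpace I x) : g.pair X Y = g.pair Y X := by
  ext x; exact g.symm x _ _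

theorem ext_val {x : M} {v v' : TangentSpace I x} (h : ∀ w, g.val x v w = g.val x v' w) :
    v = v' := by
  rw [← sub_eq_zero]
  refine g.nondegenerate x _ fun w ↦ ?_
  simp [h w]

/-- `(ℒ_V g)(X, Y) = V (g(X, Y)) - g([V, X], Y) - g(X, [V, Y])`, for vector fields. -/
def lieDerivAux (V X Y : Π x : M, TangentSpace I x) (x : M) : ℝ :=
  mvfderiv I (g.pair X Y) x (V x)
    - g.val x (VectorField.mlieBracket I V X x) (Y x)
    - g.val x (X x) (VectorField.mlieBracket I V Y x)

theorem lieDerivAux_comm (V X Y : Π x : M, TangentSpace I x) (x : M) :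
    g.lieDerivAux V X Y x = g.lieDerivAux V Y X x := by
  simp only [lieDerivAux, g.pair_comm X Y, g.symm x (X x), g.symm x _ (Y x)]
  ring

/-- Half of the right-hand side of the Koszul formula. -/
def koszul (X Y Z : Π x : M, TangentSpace I x) (x : M) : ℝ :=
  (mvfderiv I (g.pair Y Z) x (X x) + mvfderiv I (g.pair X Z) x (Y x)
    - mvfderiv I (g.pair X Y) x (Z x)
    + g.val x (VectorField.mlieBracket I X Y x) (Z x)
    - g.val x (VectorField.mlieBracket I X Z x) (Y x)
    - g.val x (VectorField.mlieBracket I Y Z x) (X x)) / 2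

variable [FiniteDimensional ℝ E]

/-- The musical isomorphism `T_x M ≃ T_x^* M`, `v ↦ g(v, ·)`. -/
def flat (x : M) : TangentSpace I x ≃ₗ[ℝ] (TangentSpace I x →L[ℝ] ℝ) :=
  haveI : FiniteDimensional ℝ (TangentSpace I x) := inferInstanceAs (FiniteDimensional ℝ E)
  LinearEquiv.ofInjectiveOfFinrankEq (g.val x).toLinearMap
    (by
      rw [← LinearMap.ker_eq_bot, LinearMap.ker_eq_bot']
      intro v hv
      refine g.nondegenerate x v fun w ↦ ?_
      exact congrArg (fun φ : TangentSpace I x →L[ℝ] ℝ ↦ φ w) hv)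
    (by
      change Module.finrank ℝ E = Module.finrank ℝ (E →L[ℝ] ℝ)
      rw [← (LinearMap.toContinuousLinearMap (𝕜 := ℝ) (E := E) (F' := ℝ)).finrank_eq]
      exact (Subspace.dual_finrank_eq (K := ℝ) (V := E)).symm)

@[simp] theorem flat_apply (x : M) (v w : TangentSpace I x) : g.flat x v w = g.val x v w := rfl

@[simp] theorem val_flat_symm (x : M) (φ : TangentSpace I x →L[ℝ] ℝ) (w : TangentSpace I x) :
    g.val x ((g.flat x).symm φ) w = φ w := by
  rw [← flat_apply, LinearEquiv.apply_symm_apply]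

/-! ### The Lie derivative of the metric -/

theorem tensorialAt_lieDerivAux₁ (V Y : Π x : M, TangentSpace I x) {x : M}
    (hY : MDiffAt (T% Y) x) :
    TensorialAt I E (fun X ↦ g.lieDerivAux V X Y x) x where
  smul hf hX := by
    simp only [lieDerivAux, pair_smul_left, mvfderiv_mul hf (g.mdifferentiableAt_pair hX hY),
      VectorField.mlieBracket_smul_right hf hX]
    simp [pair]
    ring
  add hX hX' := by
    simp only [lieDerivAux, pair_add_left, mvfderiv_add (g.mdifferentiableAt_pair hX hY)
      (g.mdifferentiableAt_pair hX' hY), VectorField.mlieBracket_add_right hX hX']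
    simp
    ring

theorem tensorialAt_lieDerivAux₂ (V X : Π x : M, TangentSpace I x) {x : M}
    (hX : MDiffAt (T% X) x) :
    TensorialAt I E (fun Y ↦ g.lieDerivAux V X Y x) x := by
  simp only [g.lieDerivAux_comm V X]
  exact g.tensorialAt_lieDerivAux₁ V X hX

/-- The Lie derivative `ℒ_V g` of the metric along the vector field `V`: the bilinear form on
`T_x M` with `(ℒ_V g)(X, Y) = V (g(X, Y)) - g([V, X], Y) - g(X, [V, Y])` for all
vector fields `X`, `Y`. -/
def lieDeriv (V : Π x : M, TangentSpace I x) (x : M) :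
    TangentSpace I x →L[ℝ] TangentSpace I x →L[ℝ] ℝ :=
  TensorialAt.mkHom₂ (fun X Y ↦ g.lieDerivAux V X Y x) x
    (fun _ hY ↦ g.tensorialAt_lieDerivAux₁ V _ hY)
    (fun _ hX ↦ g.tensorialAt_lieDerivAux₂ V _ hX)

theorem lieDeriv_apply (V : Π x : M, TangentSpace I x) {x : M} {X Y : Π x : M, TangentSpace I x}
    (hX : MDiffAt (T% X) x) (hY : MDiffAt (T% Y) x) :
    g.lieDeriv V x (X x) (Y x) = mvfderiv I (g.pair X Y) x (V x)
      - g.val x (VectorField.mlieBracket I V X x) (Y x)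
      - g.val x (X x) (VectorField.mlieBracket I V Y x) :=
  TensorialAt.mkHom₂_apply _ _ hX hY

/-! ### The Levi-Civita connection -/

theorem tensorialAt_koszul₁ {Y Z : Π x : M, TangentSpace I x} {x : M}
    (hY : MDiffAt (T% Y) x) (hZ : MDiffAt (T% Z) x) :
    TensorialAt I E (fun X ↦ g.koszul X Y Z x) x where
  smul hf hX := by
    simp only [koszul, pair_smul_left, mvfderiv_mul hf (g.mdifferentiableAt_pair hX hY),
      mvfderiv_mul hf (g.mdifferentiableAt_pair hX hZ), VectorField.mlieBracket_smul_left hf hX]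
    simp [pair, g.symm x _ (Z x), g.symm x _ (Y x)]
    ring
  add hX hX' := by
    simp only [koszul, pair_add_left, mvfderiv_add (g.mdifferentiableAt_pair hX hY)
      (g.mdifferentiableAt_pair hX' hY), mvfderiv_add (g.mdifferentiableAt_pair hX hZ)
      (g.mdifferentiableAt_pair hX' hZ), VectorField.mlieBracket_add_left hX hX']
    simp
    ring

theorem tensorialAt_koszul₃ {X Y : Π x : M, TangentSpace I x} {x : M}
    (hX : MDiffAt (T% X) x) (hY : MDiffAt (T% Y) x) :
    TensorialAt I E (fun Z ↦ g.koszul X Y Z x) x where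
  smul := by
    intro f Z hf hZ
    simp only [koszul, pair_smul_right, mvfderiv_mul hf (g.mdifferentiableAt_pair hX hZ),
      mvfderiv_mul hf (g.mdifferentiableAt_pair hY hZ), VectorField.mlieBracket_smul_right hf hZ]
    simp [pair, g.symm x (Z x) (Y x), g.symm x (Z x) (X x)]
    ring
  add hZ hZ' := by
    simp only [koszul, pair_add_right, mvfderiv_add (g.mdifferentiableAt_pair hX hZ)
      (g.mdifferentiableAt_pair hX hZ'), mvfderiv_add (g.mdifferentiableAt_pair hY hZ)
      (g.mdifferentiableAt_pair hY hZ'), VectorField.mlieBracket_add_right hZ hZ']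
    simp
    ring

theorem koszul_add_middle {X Y Y' Z : Π x : M, TangentSpace I x} {x : M}
    (hX : MDiffAt (T% X) x) (hY : MDiffAt (T% Y) x) (hY' : MDiffAt (T% Y') x)
    (hZ : MDiffAt (T% Z) x) :
    g.koszul X (Y + Y') Z x = g.koszul X Y Z x + g.koszul X Y' Z x := by
  simp only [koszul, pair_add_left, pair_add_right,
    mvfderiv_add (g.mdifferentiableAt_pair hX hY) (g.mdifferentiableAt_pair hX hY'),
    mvfderiv_add (g.mdifferentiableAt_pair hY hZ) (g.mdifferentiableAt_pair hY' hZ),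
    VectorField.mlieBracket_add_left hY hY', VectorField.mlieBracket_add_right hY hY']
  simp
  ring

theorem koszul_smul_middle {f : M → ℝ} {X Y Z : Π x : M, TangentSpace I x} {x : M}
    (hf : MDiffAt f x) (hX : MDiffAt (T% X) x) (hY : MDiffAt (T% Y) x) (hZ : MDiffAt (T% Z) x) :
    g.koszul X (f • Y) Z x =
      f x * g.koszul X Y Z x + mvfderiv I f x (X x) * g.val x (Y x) (Z x) := by
  simp only [koszul, pair_smul_left, pair_smul_right,
    mvfderiv_mul hf (g.mdifferentiableAt_pair hX hY),
    mvfderiv_mul hf (g.mdifferentiableAt_pair hY hZ),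
    VectorField.mlieBracket_smul_left hf hY, VectorField.mlieBracket_smul_right hf hY]
  simp [pair, g.symm x (Y x) (X x)]
  ring

/-- The 2-form `(X, Z) ↦ g(∇_X Y, Z)` given by the Koszul formula. -/
def koszulForm {Y : Π x : M, TangentSpace I x} {x : M} (hY : MDiffAt (T% Y) x) :
    TangentSpace I x →L[ℝ] TangentSpace I x →L[ℝ] ℝ :=
  TensorialAt.mkHom₂ (fun X Z ↦ g.koszul X Y Z x) x
    (fun _ hZ ↦ g.tensorialAt_koszul₁ hY hZ)
    (fun _ hX ↦ g.tensorialAt_koszul₃ hX hY)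

open Classical in
/-- The Levi-Civita connection as an operator: `∇_X Y` is determined by the Koszul formula
(it is set to `0` at points where `Y` is not differentiable). -/
def leviCivitaFun (Y : Π x : M, TangentSpace I x) (x : M) :
    TangentSpace I x →L[ℝ] TangentSpace I x :=
  haveI : FiniteDimensional ℝ (TangentSpace I x) := inferInstanceAs (FiniteDimensional ℝ E)
  haveI : T2Space (TangentSpace I x) := inferInstanceAs (T2Space E)
  if hY : MDiffAt (T% Y) x then
    LinearMap.toContinuousLinearMap
      ((g.flat x).symm.toLinearMap ∘ₗ (g.koszulForm hY).toLinearMap)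
  else 0

theorem val_leviCivitaFun {X Y Z : Π x : M, TangentSpace I x} {x : M}
    (hX : MDiffAt (T% X) x) (hY : MDiffAt (T% Y) x) (hZ : MDiffAt (T% Z) x) :
    g.val x (g.leviCivitaFun Y x (X x)) (Z x) = g.koszul X Y Z x := by
  have : g.val x (g.leviCivitaFun Y x (X x)) (Z x) = g.koszulForm hY (X x) (Z x) := by
    simp [leviCivitaFun, hY]
  rw [this]
  exact TensorialAt.mkHom₂_apply _ _ hX hZ

/-- The Levi-Civita connection of a semi-Riemannian metric. -/
def leviCivita : CovariantDerivative I E (TangentSpace I : M → Type _) where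
  toFun := g.leviCivitaFun
  isCovariantDerivativeOnUniv :=
    { add := by
        intro Y Y' x hY hY' _
        ext u
        refine g.ext_val fun w ↦ ?_
        have hu := mdifferentiableAt_extend I E u
        have hw := mdifferentiableAt_extend I E w
        have h := g.koszul_add_middle hu hY hY' hw
        rw [← g.val_leviCivitaFun hu (mdifferentiableAt_add_section hY hY') hw,
          ← g.val_leviCivitaFun hu hY hw, ← g.val_leviCivitaFun hu hY' hw] at h
        simpa using h
      leibniz := by
        intro Y f x hY hf _
        ext u
        refine g.ext_val fun w ↦ ?_
        have hu := mdifferentiableAt_extend I E u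
        have hw := mdifferentiableAt_extend I E w
        have h := g.koszul_smul_middle hf hu hY hw
        rw [← g.val_leviCivitaFun hu (hf.smul_section hY) hw,
          ← g.val_leviCivitaFun hu hY hw] at h
        simpa using h }

/-- The Levi-Civita connection is torsion-free. -/
theorem leviCivita_torsionFree {X Y : Π x : M, TangentSpace I x} {x : M}
    (hX : MDiffAt (T% X) x) (hY : MDiffAt (T% Y) x) :
    g.leviCivita Y x (X x) - g.leviCivita X x (Y x) = VectorField.mlieBracket I X Y x := by
  refine g.ext_val fun w ↦ ?_
  have hw := mdifferentiableAt_extend I E w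
  have h₁ := g.val_leviCivitaFun hX hY hw
  have h₂ := g.val_leviCivitaFun hY hX hw
  simp only [extend_apply_self] at h₁ h₂
  change g.val x (g.leviCivitaFun Y x (X x) - g.leviCivitaFun X x (Y x)) w = _
  rw [map_sub, sub_apply, h₁, h₂]
  simp only [koszul, g.pair_comm X Y, extend_apply_self]
  rw [VectorField.mlieBracket_swap (V := Y) (W := X)]
  simp
  ring

/-- The Levi-Civita connection is compatible with the metric. -/
theorem leviCivita_metric {X Y Z : Π x : M, TangentSpace I x} {x : M}
    (hX : MDiffAt (T% X) x) (hY : MDiffAt (T% Y) x) (hZ : MDiffAt (T% Z) x) :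
    mvfderiv I (g.pair Y Z) x (X x) =
      g.val x (g.leviCivita Y x (X x)) (Z x) + g.val x (Y x) (g.leviCivita Z x (X x)) := by
  rw [g.symm x (Y x)]
  change _ = g.val x (g.leviCivitaFun Y x (X x)) (Z x) + g.val x (g.leviCivitaFun Z x (X x)) (Y x)
  rw [g.val_leviCivitaFun hX hY hZ, g.val_leviCivitaFun hX hZ hY]
  simp only [koszul, g.pair_comm Z Y]
  rw [VectorField.mlieBracket_swap (V := Z) (W := Y)]
  simp
  ring

end

section Hypersurface

variable {E : Type*} [NormedAddCommGroup E] [NormedSpace ℝ E]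
  {H : Type*} [TopologicalSpace H] {I : ModelWithCorners ℝ E H}
  {M : Type*} [TopologicalSpace M] [ChartedSpace H M] [IsManifold I ∞ M]
  {E' : Type*} [NormedAddCommGroup E'] [NormedSpace ℝ E']
  {H' : Type*} [TopologicalSpace H'] {I' : ModelWithCorners ℝ E' H'}
  {M' : Type*} [TopologicalSpace M'] [ChartedSpace H' M'] [IsManifold I' ∞ M']

/-- `f : (M, g) → (M', g')` is a (smooth) isometric immersion. -/
structure IsIsometricImmersion (g : SemiRiemannianMetric I M) (g' : SemiRiemannianMetric I' M')
    (f : M → M') : Prop where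
  contMDiff : ContMDiff I I' ∞ f
  injective (x : M) : Function.Injective (mfderiv I I' f x)
  val_eq (x : M) (u v : TangentSpace I x) :
    g'.val (f x) (mfderiv I I' f x u) (mfderiv I I' f x v) = g.val x u v

/-- `N` is a smooth field, along `f : M → M'`, of unit vectors normal to `M`. A vector is a unit
vector if its scalar square is `1` or `-1`. -/
structure IsUnitNormalField (I : ModelWithCorners ℝ E H) {M : Type*} [TopologicalSpace M]
    [ChartedSpace H M] (g' : SemiRiemannianMetric I' M') (f : M → M')
    (N : Π x : M, TangentSpace I' (f x)) : Prop where
  contMDiff : ContMDiff I I'.tangent ∞ (fun x : M ↦ (⟨f x, N x⟩ : TangentBundle I' M'))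
  normal (x : M) (u : TangentSpace I x) : g'.val (f x) (N x) (mfderiv I I' f x u) = 0
  unit (x : M) : g'.val (f x) (N x) (N x) = 1 ∨ g'.val (f x) (N x) (N x) = -1

/-- The covariant derivative of a vector field `W` along a map `f : M → M'`, induced by a
connection `∇'` on `M'`. If `W = ∑ᵢ wᵢ (eᵢ ∘ f)` near `x`, for the local frame `(eᵢ)` of `TM'` given
by the trivialization around `f x`, then it maps `u` to
`∑ᵢ dwᵢ(u) eᵢ(f x) + ∑ᵢ wᵢ(x) ∇'_{df(u)} eᵢ`. -/
def covDerivAlong (I : ModelWithCorners ℝ E H) {M : Type*} [TopologicalSpace M]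
    [ChartedSpace H M] (cov : CovariantDerivative I' E' (TangentSpace I' : M' → Type _))
    (f : M → M') (W : Π x : M, TangentSpace I' (f x)) (x : M) :
    TangentSpace I x →L[ℝ] TangentSpace I' (f x) :=
  let t := trivializationAt E' (TangentSpace I' : M' → Type _) (f x)
  (t.symmL ℝ (f x)).comp (mvfderiv I (fun y ↦ (t ⟨f y, W y⟩).2) x)
    + (cov (extend E' (W x)) (f x)).comp (mfderiv I I' f x)

/-! The induced covariant derivative along `f` extends the connection on `M'`. -/

theorem mdifferentiableAt_coord {W : Π y : M', TangentSpace I' y} {y : M'}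
    (hW : MDiffAt (T% W) y) :
    MDifferentiableAt I' 𝓘(ℝ, E')
      (fun z ↦ (trivializationAt E' (TangentSpace I' : M' → Type _) y ⟨z, W z⟩).2) y :=
  ((mdifferentiableAt_totalSpace I' _).1 hW).2

theorem tensorialAt_sub_coord
    (cov : CovariantDerivative I' E' (TangentSpace I' : M' → Type _)) (y : M') :
    TensorialAt I' E' (fun W : (Π y : M', TangentSpace I' y) ↦ cov W y -
      ((trivializationAt E' (TangentSpace I' : M' → Type _) y).symmL ℝ y).comp (mvfderiv I'
        (fun z ↦ (trivializationAt E' (TangentSpace I' : M' → Type _) y ⟨z, W z⟩).2) y)) y where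
  smul := by
    intro φ W hφ hW
    set t := trivializationAt E' (TangentSpace I' : M' → Type _) y with ht
    have hy : y ∈ t.baseSet := FiberBundle.mem_baseSet_trivializationAt' y
    have h1 : cov (φ • W) y = φ y • cov W y + (mvfderiv I' φ y).smulRight (W y) :=
      cov.isCovariantDerivativeOnUniv.leibniz hW hφ
    have h2 : mvfderiv I' (fun z ↦ (t ⟨z, (φ • W) z⟩).2) y =
        φ y • mvfderiv I' (fun z ↦ (t ⟨z, W z⟩).2) y
          + (mvfderiv I' φ y).smulRight ((t ⟨y, W y⟩).2) := by
      rw [← mvfderiv_smul hφ (mdifferentiableAt_coord hW)]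
      have : (fun z ↦ (t ⟨z, (φ • W) z⟩).2) =ᶠ[nhds y] (φ • fun z ↦ (t ⟨z, W z⟩).2) :=
        Filter.eventually_of_mem (t.open_baseSet.mem_nhds hy)
          fun z hz ↦ ((t.linear ℝ hz).map_smul _ _)
      ext u
      simp only [mvfderiv, this.mfderiv_eq]
      rfl
    have h3 : t.symmL ℝ y (t ⟨y, W y⟩).2 = W y := by
      rw [t.symmL_apply hy]
      exact t.symm_apply_apply_mk hy (W y)
    rw [h1, h2]
    ext u
    change φ y • cov W y u + mvfderiv I' φ y u • W y
        - t.symmL ℝ y (φ y • mvfderiv I' (fun z ↦ (t ⟨z, W z⟩).2) y u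
          + mvfderiv I' φ y u • (t ⟨y, W y⟩).2)
      = φ y • (cov W y u - t.symmL ℝ y (mvfderiv I' (fun z ↦ (t ⟨z, W z⟩).2) y u))
    rw [map_add, map_smul, map_smul, h3]
    module
  add := by
    intro W W' hW hW'
    set t := trivializationAt E' (TangentSpace I' : M' → Type _) y with ht
    have hy : y ∈ t.baseSet := FiberBundle.mem_baseSet_trivializationAt' y
    have h1 : cov (W + W') y = cov W y + cov W' y :=
      cov.isCovariantDerivativeOnUniv.add hW hW'
    have h2 : mvfderiv I' (fun z ↦ (t ⟨z, (W + W') z⟩).2) y =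
        mvfderiv I' (fun z ↦ (t ⟨z, W z⟩).2) y + mvfderiv I' (fun z ↦ (t ⟨z, W' z⟩).2) y := by
      rw [← mvfderiv_add (mdifferentiableAt_coord hW) (mdifferentiableAt_coord hW')]
      have : (fun z ↦ (t ⟨z, (W + W') z⟩).2) =ᶠ[nhds y]
          ((fun z ↦ (t ⟨z, W z⟩).2) + fun z ↦ (t ⟨z, W' z⟩).2) :=
        Filter.eventually_of_mem (t.open_baseSet.mem_nhds hy)
          fun z hz ↦ ((t.linear ℝ hz).map_add _ _)
      ext u
      simp only [mvfderiv, this.mfderiv_eq]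
      rfl
    rw [h1, h2]
    ext u
    simp
    abel

/-- If `W` is a vector field on `M'`, the covariant derivative of `W ∘ f` along `f` in the
direction `u` is `∇'_{df(u)} W`. -/
theorem covDerivAlong_comp [FiniteDimensional ℝ E']
    (cov : CovariantDerivative I' E' (TangentSpace I' : M' → Type _))
    {f : M → M'} {x : M} {W : Π y : M', TangentSpace I' y}
    (hf : MDifferentiableAt I I' f x) (hW : MDiffAt (T% W) (f x)) :
    covDerivAlong I cov f (fun x ↦ W (f x)) x = (cov W (f x)).comp (mfderiv I I' f x) := by
  set t := trivializationAt E' (TangentSpace I' : M' → Type _) (f x) with ht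
  have hy : f x ∈ t.baseSet := FiberBundle.mem_baseSet_trivializationAt' (f x)
  have key := (tensorialAt_sub_coord cov (f x)).pointwise hW
    (mdifferentiableAt_extend I' E' (W (f x))) (by simp)
  have hc : mvfderiv I' (fun z ↦ (t ⟨z, extend E' (W (f x)) z⟩).2) (f x) = 0 := by
    have : (fun z ↦ (t ⟨z, extend E' (W (f x)) z⟩).2) =ᶠ[nhds (f x)]
        fun _ ↦ (t ⟨f x, W (f x)⟩).2 :=
      Filter.eventually_of_mem (t.open_baseSet.mem_nhds hy) fun z hz ↦ by
        have := congrArg Prod.snd (t.apply_mk_symm hz (t ⟨f x, W (f x)⟩).2)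
        exact this
    unfold mvfderiv
    rw [this.mfderiv_eq, mfderiv_const]
    exact ContinuousLinearMap.comp_zero _
  simp only [← ht, hc] at key
  have hd : mvfderiv I (fun q ↦ (t ⟨f q, W (f q)⟩).2) x =
      (mvfderiv I' (fun z ↦ (t ⟨z, W z⟩).2) (f x)).comp (mfderiv I I' f x) := by
    have := mfderiv_comp x (mdifferentiableAt_coord hW) hf
    ext u
    exact congrArg (fun L : TangentSpace I x →L[ℝ] E' ↦ L u) this
  ext u
  have key' := congrArg (fun L : TangentSpace I' (f x) →L[ℝ] TangentSpace I' (f x) ↦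
    L (mfderiv I I' f x u)) key
  simp only [covDerivAlong, ← ht, hd]
  simp at key' ⊢
  rw [← key']
  abel

variable [FiniteDimensional ℝ E]

/-- The tangential part of `w ∈ T_{f x} M'`: the vector `v ∈ T_x M` such that `w - df(v)` is
orthogonal to the tangent space of `M`. -/
def tangentialPart (g : SemiRiemannianMetric I M) (g' : SemiRiemannianMetric I' M')
    (f : M → M') (x : M) (w : TangentSpace I' (f x)) : TangentSpace I x :=
  (g.flat x).symm ((g'.val (f x) w).comp (mfderiv I I' f x))

theorem val_tangentialPart (g : SemiRiemannianMetric I M) (g' : SemiRiemannianMetric I' M')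
    (f : M → M') (x : M) (w : TangentSpace I' (f x)) (u : TangentSpace I x) :
    g.val x (tangentialPart g g' f x w) u = g'.val (f x) w (mfderiv I I' f x u) := by
  simp [tangentialPart]

theorem tangentialPart_eq_iff {g : SemiRiemannianMetric I M} {g' : SemiRiemannianMetric I' M'}
    {f : M → M'} (hf : IsIsometricImmersion g g' f) (x : M) (w : TangentSpace I' (f x))
    (v : TangentSpace I x) :
    tangentialPart g g' f x w = v ↔
      ∀ u, g'.val (f x) (w - mfderiv I I' f x v) (mfderiv I I' f x u) = 0 := by
  constructor
  · rintro rfl u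
    simp [hf.val_eq, val_tangentialPart]
  · intro h
    refine g.ext_val fun u ↦ ?_
    have := h u
    rw [map_sub, sub_apply, hf.val_eq, sub_eq_zero] at this
    rw [val_tangentialPart, this]

/-- The Weingarten operator of an isometric immersion with respect to the unit normal field `N`:
`A u = -(∇'_u N)^⊤`, where `∇'` is the Levi-Civita connection of the ambient manifold. -/
def weingarten [FiniteDimensional ℝ E'] (g : SemiRiemannianMetric I M)
    (g' : SemiRiemannianMetric I' M') (f : M → M') (N : Π x : M, TangentSpace I' (f x)) (x : M)
    (u : TangentSpace I x) : TangentSpace I x :=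
  -tangentialPart g g' f x (covDerivAlong I g'.leviCivita f N x u)

end Hypersurface

end SemiRiemannianMetric

end

open VectorField in
/-- The commutator formula `dF([V, W]) = V(W F) - W(V F)`. -/
theorem mvfderiv_mlieBracket {E : Type*} [NormedAddCommGroup E] [NormedSpace ℝ E] [CompleteSpace E]
    {H : Type*} [TopologicalSpace H] {I : ModelWithCorners ℝ E H} [I.Boundaryless]
    {M : Type*} [TopologicalSpace M] [ChartedSpace H M] [IsManifold I ∞ M]
    {G : Type*} [NormedAddCommGroup G] [NormedSpace ℝ G] {F : M → G} {x : M}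
    {V W : Π x : M, TangentSpace I x} (hF : ContMDiffAt I 𝓘(ℝ, G) 2 F x)
    (hV : MDiffAt (T% V) x) (hW : MDiffAt (T% W) x) :
    mvfderiv I F x (mlieBracket I V W x) =
      mvfderiv I (fun y ↦ mvfderiv I F y (W y)) x (V x)
        - mvfderiv I (fun y ↦ mvfderiv I F y (V y)) x (W x) := by
  set φ := extChartAt I x with hφ
  set Fh : E → G := F ∘ φ.symm with hFh
  have hFh2 : ContDiffAt ℝ 2 Fh (φ x) := by
    have := (contMDiffAt_iff.1 hF).2
    rw [I.range_eq_univ, contDiffWithinAt_univ] at this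
    exact this
  have hsource : φ.source ∈ nhds x := extChartAt_source_mem_nhds x
  have hev : ∀ᶠ y in nhds x, y ∈ φ.source ∧ MDifferentiableAt I 𝓘(ℝ, G) F y := by
    filter_upwards [hsource, (contMDiffAt_iff_contMDiffAt_nhds (by simp)).1 hF] with y hy hFy
    exact ⟨hy, hFy.mdifferentiableAt (by simp)⟩
  have hder (y : M) (hy : y ∈ φ.source) (hFy : MDifferentiableAt I 𝓘(ℝ, G) F y)
      (u : TangentSpace I y) :
      mvfderiv I F y u = fderiv ℝ Fh (φ y) (mfderiv I 𝓘(ℝ, E) φ y u) := by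
    have hsymm : MDifferentiableAt 𝓘(ℝ, E) I φ.symm (φ y) := by
      have := mdifferentiableWithinAt_extChartAt_symm (I := I) (φ.map_source hy)
      rwa [I.range_eq_univ, mdifferentiableWithinAt_univ] at this
    have h1 : MDifferentiableAt 𝓘(ℝ, E) 𝓘(ℝ, G) Fh (φ y) :=
      MDifferentiableAt.comp (φ y) (by rwa [φ.left_inv hy]) hsymm
    have h2 : F =ᶠ[nhds y] Fh ∘ φ :=
      Filter.eventually_of_mem ((isOpen_extChartAt_source x).mem_nhds hy) fun z hz ↦ by
        simp [hFh, φ.left_inv hz]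
    have h3 : MDifferentiableAt I 𝓘(ℝ, E) φ y :=
      mdifferentiableAt_extChartAt (by simpa [hφ] using hy)
    have h4 := mfderiv_comp y h1 h3
    rw [← h2.mfderiv_eq, mfderiv_eq_fderiv] at h4
    exact congrArg (fun L : E →L[ℝ] G ↦ L u) h4
  have hpull (U : Π x : M, TangentSpace I x) {y : M} (hy : y ∈ φ.source) :
      mpullbackWithin 𝓘(ℝ, E) I φ.symm U (Set.range I) (φ y) = mfderiv I 𝓘(ℝ, E) φ y (U y) := by
    have hc := mfderivWithin_extChartAt_symm_comp_mfderiv_extChartAt' (I := I) hy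
    have hi := isInvertible_mfderivWithin_extChartAt_symm (I := I) (φ.map_source hy)
    rw [mpullbackWithin_apply]
    have key (y' : M) (h : y' = y) (L : E →L[ℝ] E) (hL : L.IsInvertible)
        (hL' : ∀ v, L (mfderiv I 𝓘(ℝ, E) φ y v) = v) :
        L.inverse (U y') = mfderiv I 𝓘(ℝ, E) φ y (U y) := by
      subst h
      conv_lhs => rw [← hL' (U y')]
      exact hL.inverse_apply_self _
    exact key _ (φ.left_inv hy) _ hi fun v ↦ congrArg (fun L : E →L[ℝ] E ↦ L v) hc
  have hid (v : TangentSpace I x) : mfderiv I 𝓘(ℝ, E) φ x v = v := by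
    rw [hφ, mfderiv_extChartAt_self]; rfl
  have hmain (U : Π x : M, TangentSpace I x) (hU : MDiffAt (T% U) x) (u : TangentSpace I x) :
      mpullbackWithin 𝓘(ℝ, E) I φ.symm U (Set.range I) (φ x) = U x ∧
      mvfderiv I (fun y ↦ mvfderiv I F y (U y)) x u =
        fderiv ℝ (fderiv ℝ Fh) (φ x) u (U x) + fderiv ℝ Fh (φ x)
          (fderiv ℝ (mpullbackWithin 𝓘(ℝ, E) I φ.symm U (Set.range I)) (φ x) u) := by
    have hd : DifferentiableAt ℝ (mpullbackWithin 𝓘(ℝ, E) I φ.symm U (Set.range I)) (φ x) := by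
      have := MDifferentiableWithinAt.differentiableWithinAt_mpullbackWithin_vectorField
        (mdifferentiableWithinAt_univ.2 hU)
      rw [Set.preimage_univ, Set.univ_inter] at this
      exact this.differentiableAt (by rw [I.range_eq_univ]; exact Filter.univ_mem)
    have hx : mpullbackWithin 𝓘(ℝ, E) I φ.symm U (Set.range I) (φ x) = U x := by
      rw [hpull U (mem_extChartAt_source x)]; exact hid _
    refine ⟨hx, ?_⟩
    set Uh : E → E := mpullbackWithin 𝓘(ℝ, E) I φ.symm U (Set.range I) with hUh
    have hFd : DifferentiableAt ℝ (fderiv ℝ Fh) (φ x) :=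
      (hFh2.fderiv_right (m := 1) (by norm_num)).differentiableAt (by simp)
    have h1 : (fun y ↦ mvfderiv I F y (U y)) =ᶠ[nhds x]
        (fun z ↦ fderiv ℝ Fh z (Uh z)) ∘ φ := by
      filter_upwards [hev] with y hy
      rw [hder y hy.1 hy.2, ← hpull U hy.1]
      rfl
    have h2 : DifferentiableAt ℝ (fun z ↦ fderiv ℝ Fh z (Uh z)) (φ x) := hFd.clm_apply hd
    have h3 := mfderiv_comp x h2.mdifferentiableAt (mdifferentiableAt_extChartAt (I := I) (by simp))
    have h4 : mvfderiv I (fun y ↦ mvfderiv I F y (U y)) x u =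
        fderiv ℝ (fun z ↦ fderiv ℝ Fh z (Uh z)) (φ x) u := by
      rw [mfderiv_extChartAt_self, mfderiv_eq_fderiv] at h3
      change mfderiv I 𝓘(ℝ, G) (fun y ↦ mvfderiv I F y (U y)) x u = _
      rw [h1.mfderiv_eq]
      exact congrArg (fun L : E →L[ℝ] G ↦ L u) h3
    rw [h4, fderiv_clm_apply hFd hd]
    change fderiv ℝ Fh (φ x) (fderiv ℝ Uh (φ x) u) + fderiv ℝ (fderiv ℝ Fh) (φ x) u (Uh (φ x)) = _
    rw [hx, add_comm]
  have hsymm : IsSymmSndFDerivAt ℝ Fh (φ x) := hFh2.isSymmSndFDerivAt (by simp)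
  obtain ⟨hV1, hV2⟩ := hmain V hV (W x)
  obtain ⟨hW1, hW2⟩ := hmain W hW (V x)
  have hbr : mlieBracket I V W x =
      fderiv ℝ (mpullbackWithin 𝓘(ℝ, E) I φ.symm W (Set.range I)) (φ x) (V x) -
      fderiv ℝ (mpullbackWithin 𝓘(ℝ, E) I φ.symm V (Set.range I)) (φ x) (W x) := by
    rw [← mlieBracketWithin_univ, mlieBracketWithin_apply, mfderiv_extChartAt_self]
    have hb (A B : E → E) (z : E) :
        lieBracketWithin ℝ A B (((extChartAt I x).symm ⁻¹' Set.univ) ∩ Set.range I) z =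
          fderiv ℝ B z (A z) - fderiv ℝ A z (B z) := by
      rw [Set.preimage_univ, Set.univ_inter, I.range_eq_univ, lieBracketWithin_univ, lieBracket]
    have hi (v : E) : (ContinuousLinearMap.id ℝ E).inverse v = v := by simp
    refine (hi _).trans ((hb _ _ _).trans ?_)
    rw [← hφ, hV1, hW1]
  have hx0 : mvfderiv I F x (mlieBracket I V W x) = fderiv ℝ Fh (φ x) (mlieBracket I V W x) := by
    rw [hder x (mem_extChartAt_source x) (hF.mdifferentiableAt (by simp)), hid]
  rw [hV2, hW2, hx0, hbr]
  have := hsymm (V x) (W x)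
  rw [map_sub]
  erw [this]
  abel

theorem mvfderiv_clm_apply {E : Type*} [NormedAddCommGroup E] [NormedSpace ℝ E]
    {H : Type*} [TopologicalSpace H] {I : ModelWithCorners ℝ E H}
    {M : Type*} [TopologicalSpace M] [ChartedSpace H M]
    {F G : Type*} [NormedAddCommGroup G] [NormedSpace ℝ G] [NormedAddCommGroup F] [NormedSpace ℝ F]
    {c : M → F →L[ℝ] G} {u : M → F} {x : M} (hc : MDifferentiableAt I 𝓘(ℝ, F →L[ℝ] G) c x)
    (hu : MDifferentiableAt I 𝓘(ℝ, F) u x) (v : TangentSpace I x) :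
    mvfderiv I (fun y ↦ c y (u y)) x v = c x (mvfderiv I u x v) + mvfderiv I c x v (u x) := by
  let u' : E →L[ℝ] F := mvfderiv I u x
  let c' : E →L[ℝ] F →L[ℝ] G := mvfderiv I c x
  have hx : (extChartAt I x).symm (extChartAt I x x) = x := extChartAt_to_inv x
  have : HasMFDerivAt I 𝓘(ℝ, G) (fun y ↦ c y (u y)) x ((c x).comp u' + c'.flip (u x)) := by
    refine ⟨hc.continuousAt.clm_apply hu.continuousAt, ?_⟩
    have h : HasFDerivWithinAt _ ((c _).comp u' + c'.flip (u _)) _ _ :=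
      hc.hasMFDerivAt.2.clm_apply hu.hasMFDerivAt.2
    rw [hx] at h
    exact h
  exact congrArg (fun L : E →L[ℝ] G ↦ L v) this.mfderiv

theorem mvfderiv_fun_comp_apply {E : Type*} [NormedAddCommGroup E] [NormedSpace ℝ E]
    {H : Type*} [TopologicalSpace H] {I : ModelWithCorners ℝ E H}
    {M : Type*} [TopologicalSpace M] [ChartedSpace H M]
    {E' : Type*} [NormedAddCommGroup E'] [NormedSpace ℝ E']
    {H' : Type*} [TopologicalSpace H'] {I' : ModelWithCorners ℝ E' H'}
    {M' : Type*} [TopologicalSpace M'] [ChartedSpace H' M']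
    {G : Type*} [NormedAddCommGroup G] [NormedSpace ℝ G]
    {φ : M' → G} {f : M → M'} {x : M} (hφ : MDifferentiableAt I' 𝓘(ℝ, G) φ (f x))
    (hf : MDifferentiableAt I I' f x) (v : TangentSpace I x) :
    mvfderiv I (fun y ↦ φ (f y)) x v = mvfderiv I' φ (f x) (mfderiv I I' f x v) :=
  congrArg (fun L : E →L[ℝ] G ↦ L v) (mfderiv_comp x hφ hf)

theorem Filter.EventuallyEq.mvfderiv_eq {E : Type*} [NormedAddCommGroup E] [NormedSpace ℝ E]
    {H : Type*} [TopologicalSpace H] {I : ModelWithCorners ℝ E H}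
    {M : Type*} [TopologicalSpace M] [ChartedSpace H M]
    {G : Type*} [NormedAddCommGroup G] [NormedSpace ℝ G] {φ ψ : M → G} {x : M}
    (h : φ =ᶠ[nhds x] ψ) : mvfderiv I φ x = mvfderiv I ψ x := by
  ext v
  exact congrArg (fun L : E →L[ℝ] G ↦ L v) h.mfderiv_eq

section TangentTrivialization

variable {E : Type*} [NormedAddCommGroup E] [NormedSpace ℝ E]
  {H : Type*} [TopologicalSpace H] {I : ModelWithCorners ℝ E H}
  {M : Type*} [TopologicalSpace M] [ChartedSpace H M] [IsManifold I ∞ M]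

theorem trivializationAt_tangent_snd {x y : M}
    (hy : y ∈ (trivializationAt E (TangentSpace I : M → Type _) x).baseSet)
    (v : TangentSpace I y) :
    (trivializationAt E (TangentSpace I : M → Type _) x ⟨y, v⟩).2 =
      mvfderiv I (extChartAt I x) y v := by
  have h := TangentBundle.continuousLinearMapAt_trivializationAt (I := I) (x₀ := x) (x := y)
    (by simpa using hy)
  have h' := congrArg (fun L : E →L[ℝ] E ↦ L v) h
  refine Eq.trans ?_ h'
  exact (Trivialization.continuousLinearMapAt_apply_of_mem ℝ _ hy v).symm

open VectorField in
/-- The fields with constant coordinates in a chart commute. -/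
theorem mlieBracket_extend [FiniteDimensional ℝ E] [I.Boundaryless] {x : M}
    (v w : TangentSpace I x) :
    mlieBracket I (extend E v) (extend E w) x = 0 := by
  set t := trivializationAt E (TangentSpace I : M → Type _) x with ht
  have hx : t.baseSet ∈ nhds x :=
    t.open_baseSet.mem_nhds (FiberBundle.mem_baseSet_trivializationAt' x)
  have : CompleteSpace E := FiniteDimensional.complete ℝ E
  have hc (u : TangentSpace I x) : mvfderiv I
      (fun y ↦ mvfderiv I (extChartAt I x) y (extend E u y)) x = 0 := by
    rw [Filter.EventuallyEq.mvfderiv_eq (ψ := fun _ ↦ (t ⟨x, u⟩).2), mvfderiv_const]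
    filter_upwards [hx] with y hy
    rw [← trivializationAt_tangent_snd hy]
    have := congrArg Prod.snd (t.apply_mk_symm hy (t ⟨x, u⟩).2)
    exact this
  have h := mvfderiv_mlieBracket (I := I) (F := extChartAt I x) (x := x)
    (contMDiffAt_extChartAt (n := 2)) (mdifferentiableAt_extend I E v)
    (mdifferentiableAt_extend I E w)
  rw [hc, hc] at h
  have hid (u : TangentSpace I x) : mvfderiv I (extChartAt I x) x u = u := by
    change mfderiv I 𝓘(ℝ, E) (extChartAt I x) x u = u
    rw [mfderiv_extChartAt_self]; rfl
  rw [hid] at h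
  exact h.trans (sub_self (0 : E))

end TangentTrivialization

noncomputable section

namespace SemiRiemannianMetric

section

variable {E : Type*} [NormedAddCommGroup E] [NormedSpace ℝ E]
  {H : Type*} [TopologicalSpace H] {I : ModelWithCorners ℝ E H}
  {M : Type*} [TopologicalSpace M] [ChartedSpace H M] [IsManifold I ∞ M]
  (g : SemiRiemannianMetric I M)

/-- The metric at `y`, read in the trivialization of the tangent bundle around `x`. -/
def inTrivialization (x y : M) : E →L[ℝ] E →L[ℝ] ℝ :=
  ContinuousLinearMap.inCoordinates E (TangentSpace I : M → Type _) (E →L[ℝ] ℝ)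
    (fun z : M ↦ TangentSpace I z →L[ℝ] Bundle.Trivial M ℝ z) x y x y (g.val y)

theorem contMDiffAt_inTrivialization (x : M) :
    ContMDiffAt I 𝓘(ℝ, E →L[ℝ] E →L[ℝ] ℝ) ∞ (g.inTrivialization x) x :=
  ((contMDiffAt_hom_bundle _).1 (g.contMDiff x)).2

theorem inTrivialization_apply {x y : M}
    (hy : y ∈ (trivializationAt E (TangentSpace I : M → Type _) x).baseSet) (a b : E) :
    g.inTrivialization x y a b =
      g.val y ((trivializationAt E (TangentSpace I : M → Type _) x).symm y a)
        ((trivializationAt E (TangentSpace I : M → Type _) x).symm y b) := by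
  unfold inTrivialization
  rw [inCoordinates_apply_eq₂ hy hy (by simp)]
  simp

theorem val_eq_inTrivialization {x y : M}
    (hy : y ∈ (trivializationAt E (TangentSpace I : M → Type _) x).baseSet)
    (v w : TangentSpace I y) :
    g.val y v w = g.inTrivialization x y
      (trivializationAt E (TangentSpace I : M → Type _) x ⟨y, v⟩).2
      (trivializationAt E (TangentSpace I : M → Type _) x ⟨y, w⟩).2 := by
  rw [g.inTrivialization_apply hy, Trivialization.symm_apply_apply_mk _ hy,
    Trivialization.symm_apply_apply_mk _ hy]

theorem mvfderiv_inTrivialization [FiniteDimensional ℝ E] {x : M} (u v w : TangentSpace I x) :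
    mvfderiv I (g.inTrivialization x) x u
        (trivializationAt E (TangentSpace I : M → Type _) x ⟨x, v⟩).2
        (trivializationAt E (TangentSpace I : M → Type _) x ⟨x, w⟩).2 =
      g.val x (g.leviCivita (extend E v) x u) w + g.val x v (g.leviCivita (extend E w) x u) := by
  set t := trivializationAt E (TangentSpace I : M → Type _) x with ht
  have hx : t.baseSet ∈ nhds x :=
    t.open_baseSet.mem_nhds (FiberBundle.mem_baseSet_trivializationAt' x)
  have hG : MDifferentiableAt I 𝓘(ℝ, E →L[ℝ] E →L[ℝ] ℝ) (g.inTrivialization x) x :=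
    (g.contMDiffAt_inTrivialization x).mdifferentiableAt (by simp)
  have h := g.leviCivita_metric (mdifferentiableAt_extend I E u) (mdifferentiableAt_extend I E v)
    (mdifferentiableAt_extend I E w)
  simp only [extend_apply_self] at h
  rw [← h, Filter.EventuallyEq.mvfderiv_eq (φ := g.pair _ _)
    (ψ := fun y ↦ g.inTrivialization x y (t ⟨x, v⟩).2 (t ⟨x, w⟩).2)]
  · have hv : MDifferentiableAt I 𝓘(ℝ, E) (fun _ ↦ (t ⟨x, v⟩).2) x := mdifferentiableAt_const
    have hw : MDifferentiableAt I 𝓘(ℝ, E) (fun _ ↦ (t ⟨x, w⟩).2) x := mdifferentiableAt_const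
    rw [mvfderiv_clm_apply (hG.clm_apply hv) hw, mvfderiv_clm_apply hG hv, mvfderiv_const,
      mvfderiv_const]
    simp
  · filter_upwards [hx] with y hy
    rw [g.inTrivialization_apply hy]
    rfl

end

section AlongMap

variable {E : Type*} [NormedAddCommGroup E] [NormedSpace ℝ E]
  {H : Type*} [TopologicalSpace H] {I : ModelWithCorners ℝ E H}
  {M : Type*} [TopologicalSpace M] [ChartedSpace H M]
  {E' : Type*} [NormedAddCommGroup E'] [NormedSpace ℝ E']
  {H' : Type*} [TopologicalSpace H'] {I' : ModelWithCorners ℝ E' H'}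
  {M' : Type*} [TopologicalSpace M'] [ChartedSpace H' M'] [IsManifold I' ∞ M']
  {f : M → M'} {x : M}

theorem mdifferentiableAt_coord_along {W : Π x : M, TangentSpace I' (f x)}
    (hW : MDifferentiableAt I I'.tangent (fun y ↦ (⟨f y, W y⟩ : TangentBundle I' M')) x) :
    MDifferentiableAt I I' f x ∧ MDifferentiableAt I 𝓘(ℝ, E')
      (fun y ↦ (trivializationAt E' (TangentSpace I' : M' → Type _) (f x) ⟨f y, W y⟩).2) x :=
  (mdifferentiableAt_totalSpace I' _).1 hW

variable [FiniteDimensional ℝ E']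

variable (g' : SemiRiemannianMetric I' M')

theorem mvfderiv_val_along {W W' : Π x : M, TangentSpace I' (f x)}
    (hW : MDifferentiableAt I I'.tangent (fun y ↦ (⟨f y, W y⟩ : TangentBundle I' M')) x)
    (hW' : MDifferentiableAt I I'.tangent (fun y ↦ (⟨f y, W' y⟩ : TangentBundle I' M')) x)
    (u : TangentSpace I x) :
    mvfderiv I (fun y ↦ g'.val (f y) (W y) (W' y)) x u =
      g'.val (f x) (covDerivAlong I g'.leviCivita f W x u) (W' x)
        + g'.val (f x) (W x) (covDerivAlong I g'.leviCivita f W' x u) := by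
  set t := trivializationAt E' (TangentSpace I' : M' → Type _) (f x) with ht
  obtain ⟨hf, hw⟩ := mdifferentiableAt_coord_along hW
  obtain ⟨-, hw'⟩ := mdifferentiableAt_coord_along hW'
  have hb : f x ∈ t.baseSet := FiberBundle.mem_baseSet_trivializationAt' (f x)
  have hx : ∀ᶠ y in nhds x, f y ∈ t.baseSet :=
    hf.continuousAt.eventually (t.open_baseSet.mem_nhds hb)
  have hG : MDifferentiableAt I' 𝓘(ℝ, E' →L[ℝ] E' →L[ℝ] ℝ) (g'.inTrivialization (f x)) (f x) :=
    (g'.contMDiffAt_inTrivialization (f x)).mdifferentiableAt (by simp)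
  have hGf : MDifferentiableAt I 𝓘(ℝ, E' →L[ℝ] E' →L[ℝ] ℝ)
      (fun y ↦ g'.inTrivialization (f x) (f y)) x := hG.comp x hf
  rw [Filter.EventuallyEq.mvfderiv_eq (ψ := fun y ↦ g'.inTrivialization (f x) (f y)
      (t ⟨f y, W y⟩).2 (t ⟨f y, W' y⟩).2)
      (by filter_upwards [hx] with y hy using g'.val_eq_inTrivialization hy _ _),
    mvfderiv_clm_apply (hGf.clm_apply hw) hw', mvfderiv_clm_apply hGf hw,
    mvfderiv_fun_comp_apply (f := f) hG hf]
  have hsymm (a : E') (v : TangentSpace I' (f x)) :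
      g'.inTrivialization (f x) (f x) a (t ⟨f x, v⟩).2 = g'.val (f x) (t.symmL ℝ (f x) a) v := by
    rw [g'.inTrivialization_apply hb, t.symm_apply_apply_mk hb, t.symmL_apply hb]
  have hsymm' (a : E') (v : TangentSpace I' (f x)) :
      g'.inTrivialization (f x) (f x) (t ⟨f x, v⟩).2 a = g'.val (f x) v (t.symmL ℝ (f x) a) := by
    rw [g'.inTrivialization_apply hb, t.symm_apply_apply_mk hb, t.symmL_apply hb]
  have hd := g'.mvfderiv_inTrivialization (mfderiv I I' f x u) (W x) (W' x)
  rw [← ht] at hd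
  simp only [covDerivAlong, ← ht, hsymm', add_apply, hsymm]
  rw [hd]
  simp only [ContinuousLinearMap.comp_apply, add_apply, map_add]
  ring

open VectorField in
theorem covDerivAlong_mfderiv_sub [IsManifold I ∞ M] [FiniteDimensional ℝ E] [I.Boundaryless]
    [I'.Boundaryless] {X Y : Π x : M, TangentSpace I x} (hf : ContMDiffAt I I' ∞ f x)
    (hX : MDiffAt (T% X) x) (hY : MDiffAt (T% Y) x) :
    covDerivAlong I g'.leviCivita f (fun y ↦ mfderiv I I' f y (Y y)) x (X x)
        - covDerivAlong I g'.leviCivita f (fun y ↦ mfderiv I I' f y (X y)) x (Y x) =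
      mfderiv I I' f x (mlieBracket I X Y x) := by
  have : CompleteSpace E := FiniteDimensional.complete ℝ E
  set t := trivializationAt E' (TangentSpace I' : M' → Type _) (f x) with ht
  have hb : f x ∈ t.baseSet := FiberBundle.mem_baseSet_trivializationAt' (f x)
  have hx : ∀ᶠ y in nhds x, f y ∈ t.baseSet ∧ MDifferentiableAt I I' f y := by
    filter_upwards [hf.continuousAt.eventually (t.open_baseSet.mem_nhds hb),
      (contMDiffAt_iff_contMDiffAt_nhds (n := 1) (by simp)).1
        (hf.of_le (by norm_cast))] with y hy hy'
    exact ⟨hy, hy'.mdifferentiableAt (by simp)⟩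
  set φ : M → E' := fun y ↦ extChartAt I' (f x) (f y) with hφ
  have hφ2 : ContMDiffAt I 𝓘(ℝ, E') 2 φ x :=
    (contMDiffAt_extChartAt (n := 2)).comp x (hf.of_le (by norm_cast))
  have hcoord (Z : Π x : M, TangentSpace I x) :
      (fun y ↦ (t ⟨f y, mfderiv I I' f y (Z y)⟩).2) =ᶠ[nhds x] fun y ↦ mvfderiv I φ y (Z y) := by
    filter_upwards [hx] with y hy
    rw [trivializationAt_tangent_snd hy.1, hφ, mvfderiv_fun_comp_apply (f := f) _ hy.2]
    exact mdifferentiableAt_extChartAt (by simpa [ht] using hy.1)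
  have htor := g'.leviCivita_torsionFree
    (mdifferentiableAt_extend I' E' (mfderiv I I' f x (X x)))
    (mdifferentiableAt_extend I' E' (mfderiv I I' f x (Y x)))
  rw [mlieBracket_extend] at htor
  simp only [extend_apply_self] at htor
  have hbr := mvfderiv_mlieBracket hφ2 hX hY
  have hend : t.symmL ℝ (f x) (mvfderiv I φ x (mlieBracket I X Y x)) =
      mfderiv I I' f x (mlieBracket I X Y x) := by
    rw [← (hcoord (mlieBracket I X Y)).eq_of_nhds, t.symmL_apply hb, t.symm_apply_apply_mk hb]
  rw [← hend, hbr, map_sub]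
  simp only [covDerivAlong, ← ht, (hcoord X).mvfderiv_eq, (hcoord Y).mvfderiv_eq, add_apply,
    ContinuousLinearMap.comp_apply]
  rw [sub_eq_zero] at htor
  rw [htor]
  abel

end AlongMap

end SemiRiemannianMetric

end

noncomputable section

namespace SemiRiemannianMetric

section

variable {E : Type*} [NormedAddCommGroup E] [NormedSpace ℝ E] [FiniteDimensional ℝ E]
  {H : Type*} [TopologicalSpace H] {I : ModelWithCorners ℝ E H}
  {M : Type*} [TopologicalSpace M] [ChartedSpace H M] [IsManifold I ∞ M]
  (g : SemiRiemannianMetric I M)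

theorem isInvertible_inTrivialization {x y : M}
    (hy : y ∈ (trivializationAt E (TangentSpace I : M → Type _) x).baseSet) :
    (g.inTrivialization x y).IsInvertible := by
  set t := trivializationAt E (TangentSpace I : M → Type _) x with ht
  have hinj : Function.Injective (g.inTrivialization x y).toLinearMap := by
    rw [← LinearMap.ker_eq_bot, LinearMap.ker_eq_bot']
    intro a ha
    have h0 : t.symm y a = 0 := by
      refine g.nondegenerate y _ fun w ↦ ?_
      have := congrArg (fun φ : E →L[ℝ] ℝ ↦ φ (t ⟨y, w⟩).2) ha
      simpa [g.inTrivialization_apply hy, ← ht, t.symm_apply_apply_mk hy] using this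
    have h1 := congrArg Prod.snd (t.apply_mk_symm hy a)
    rw [h0] at h1
    exact h1.symm.trans (t.linear ℝ hy).map_zero
  have hdim : Module.finrank ℝ E = Module.finrank ℝ (E →L[ℝ] ℝ) := by
    rw [← (LinearMap.toContinuousLinearMap (𝕜 := ℝ) (E := E) (F' := ℝ)).finrank_eq]
    exact (Subspace.dual_finrank_eq (K := ℝ) (V := E)).symm
  exact ⟨(LinearEquiv.ofInjectiveOfFinrankEq _ hinj hdim).toContinuousLinearEquiv, by ext; rfl⟩

/-- A vector field is smooth if its metric dual is. -/
theorem contMDiffAt_of_inTrivialization {x : M} {V : Π x : M, TangentSpace I x}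
    (h : ContMDiffAt I 𝓘(ℝ, E →L[ℝ] ℝ) ∞ (fun y ↦ g.inTrivialization x y
      (trivializationAt E (TangentSpace I : M → Type _) x ⟨y, V y⟩).2) x) :
    ContMDiffAt I I.tangent ∞ (fun y ↦ (⟨y, V y⟩ : TangentBundle I M)) x := by
  set t := trivializationAt E (TangentSpace I : M → Type _) x with ht
  have hx : x ∈ t.baseSet := FiberBundle.mem_baseSet_trivializationAt' x
  have : CompleteSpace E := FiniteDimensional.complete ℝ E
  refine (contMDiffAt_section x).2 ?_
  obtain ⟨e, he⟩ := g.isInvertible_inTrivialization hx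
  have hinv : ContMDiffAt I 𝓘(ℝ, (E →L[ℝ] ℝ) →L[ℝ] E) ∞
      (fun y ↦ (g.inTrivialization x y).inverse) x := by
    have h1 : ContMDiffAt 𝓘(ℝ, E →L[ℝ] E →L[ℝ] ℝ) 𝓘(ℝ, (E →L[ℝ] ℝ) →L[ℝ] E) ∞
        ContinuousLinearMap.inverse (g.inTrivialization x x) := by
      rw [← he]
      exact (contDiffAt_map_inverse e).contMDiffAt
    exact h1.comp x (g.contMDiffAt_inTrivialization x)
  refine (hinv.clm_apply h).congr_of_eventuallyEq ?_
  filter_upwards [t.open_baseSet.mem_nhds hx] with y hy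
  exact ((g.isInvertible_inTrivialization hy).inverse_apply_self _).symm

theorem lieDeriv_eq_leviCivita {x : M} {V : Π x : M, TangentSpace I x} (hV : MDiffAt (T% V) x)
    (u w : TangentSpace I x) :
    g.lieDeriv V x u w = g.val x (g.leviCivita V x u) w + g.val x u (g.leviCivita V x w) := by
  have hu := mdifferentiableAt_extend I E u
  have hw := mdifferentiableAt_extend I E w
  have h := g.lieDeriv_apply V hu hw
  rw [g.leviCivita_metric hV hu hw, ← g.leviCivita_torsionFree hV hu,
    ← g.leviCivita_torsionFree hV hw] at h
  simp only [extend_apply_self, map_sub, sub_apply] at h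
  rw [h]
  ring

end

section AlongMap

variable {E : Type*} [NormedAddCommGroup E] [NormedSpace ℝ E]
  {H : Type*} [TopologicalSpace H] {I : ModelWithCorners ℝ E H}
  {M : Type*} [TopologicalSpace M] [ChartedSpace H M] [IsManifold I ∞ M]
  {E' : Type*} [NormedAddCommGroup E'] [NormedSpace ℝ E']
  {H' : Type*} [TopologicalSpace H'] {I' : ModelWithCorners ℝ E' H'}
  {M' : Type*} [TopologicalSpace M'] [ChartedSpace H' M'] [IsManifold I' ∞ M']
  {g : SemiRiemannianMetric I M} {g' : SemiRiemannianMetric I' M'} {f : M → M'}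

theorem mdifferentiableAt_mfderiv_apply (hf : ContMDiff I I' ∞ f) {x : M}
    {X : Π x : M, TangentSpace I x} (hX : MDiffAt (T% X) x) :
    MDifferentiableAt I I'.tangent
      (fun y ↦ (⟨f y, mfderiv I I' f y (X y)⟩ : TangentBundle I' M')) x := by
  have h : ContMDiff I.tangent I'.tangent 1 (tangentMap I I' f) :=
    hf.contMDiff_tangentMap (by norm_cast)
  exact ((h (⟨x, X x⟩ : TangentBundle I M)).mdifferentiableAt (by simp)).comp x hX

variable [FiniteDimensional ℝ E]

theorem contMDiff_tangentialPart (hf : ContMDiff I I' ∞ f) {W : Π x : M, TangentSpace I' (f x)}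
    (hW : ContMDiff I I'.tangent ∞ (fun x : M ↦ (⟨f x, W x⟩ : TangentBundle I' M'))) :
    ContMDiff I I.tangent ∞
      (fun x ↦ (⟨x, tangentialPart g g' f x (W x)⟩ : TangentBundle I M)) := by
  intro x
  apply g.contMDiffAt_of_inTrivialization
  set t := trivializationAt E (TangentSpace I : M → Type _) x with ht
  set t' := trivializationAt E' (TangentSpace I' : M' → Type _) (f x) with ht'
  have hx : t.baseSet ∈ nhds x :=
    t.open_baseSet.mem_nhds (FiberBundle.mem_baseSet_trivializationAt' x)
  have hx' : ∀ᶠ y in nhds x, f y ∈ t'.baseSet := hf.continuous.continuousAt.eventually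
    (t'.open_baseSet.mem_nhds (FiberBundle.mem_baseSet_trivializationAt' (f x)))
  have hw : ContMDiffAt I 𝓘(ℝ, E') ∞ (fun y ↦ (t' ⟨f y, W y⟩).2) x :=
    ((contMDiffAt_totalSpace (E := (TangentSpace I' : M' → Type _))).1 (hW x)).2
  have hJ := (hf x).mfderiv_const (m := ∞) (by simp)
  have hG : ContMDiffAt I 𝓘(ℝ, E' →L[ℝ] E' →L[ℝ] ℝ) ∞
      (fun y ↦ g'.inTrivialization (f x) (f y)) x :=
    (g'.contMDiffAt_inTrivialization (f x)).comp x (hf x)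
  refine ((hG.clm_apply hw).clm_comp hJ).congr_of_eventuallyEq ?_
  filter_upwards [hx, hx'] with y hy hy'
  ext b
  have hJb : inTangentCoordinates I I' id f (mfderiv I I' f) x y b =
      (t' ⟨f y, mfderiv I I' f y (t.symm y b)⟩).2 := by
    have h1 := t.symmL_apply (R := ℝ) hy b
    have h2 := t'.continuousLinearMapAt_apply_of_mem ℝ hy' (mfderiv I I' f y (t.symm y b))
    rw [← h2, ← h1]
    rfl
  rw [g.inTrivialization_apply hy, t.symm_apply_apply_mk hy, val_tangentialPart,
    g'.val_eq_inTrivialization hy', ContinuousLinearMap.comp_apply, hJb]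

variable [FiniteDimensional ℝ E']

/-- The Lie derivative of an induced metric in terms of the ambient connection. -/
theorem IsIsometricImmersion.lieDeriv_eq [I.Boundaryless] [I'.Boundaryless]
    (hf : IsIsometricImmersion g g' f) {x : M} {V : Π x : M, TangentSpace I x}
    (hV : MDiffAt (T% V) x) (u w : TangentSpace I x) :
    g.lieDeriv V x u w =
      g'.val (f x) (covDerivAlong I g'.leviCivita f (fun y ↦ mfderiv I I' f y (V y)) x u)
        (mfderiv I I' f x w)
      + g'.val (f x) (mfderiv I I' f x u)
        (covDerivAlong I g'.leviCivita f (fun y ↦ mfderiv I I' f y (V y)) x w) := by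
  have hu := mdifferentiableAt_extend I E u
  have hw := mdifferentiableAt_extend I E w
  have h := g.lieDeriv_apply V hu hw
  have hpair : g.pair (extend E u) (extend E w) = fun y ↦ g'.val (f y)
      (mfderiv I I' f y (extend E u y)) (mfderiv I I' f y (extend E w y)) := by
    ext y
    exact (hf.val_eq y _ _).symm
  rw [hpair, g'.mvfderiv_val_along (mdifferentiableAt_mfderiv_apply hf.contMDiff hu)
    (mdifferentiableAt_mfderiv_apply hf.contMDiff hw), ← hf.val_eq, ← hf.val_eq,
    ← covDerivAlong_mfderiv_sub g' (hf.contMDiff x) hV hu,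
    ← covDerivAlong_mfderiv_sub g' (hf.contMDiff x) hV hw] at h
  simp only [extend_apply_self, map_sub, sub_apply] at h
  rw [h]
  ring


variable {N : Π x : M, TangentSpace I' (f x)}

/-- In codimension one, the ambient tangent space is spanned by the tangent space and the
normal vector. -/
theorem IsIsometricImmersion.exists_tangent_add_smul_normal (hf : IsIsometricImmersion g g' f)
    (hN : IsUnitNormalField I g' f N)
    (hdim : Module.finrank ℝ E' = Module.finrank ℝ E + 1) (x : M) (w : TangentSpace I' (f x)) :
    ∃ (u : TangentSpace I x) (a : ℝ), w = mfderiv I I' f x u + a • N x := by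
  have hNN : g'.val (f x) (N x) (N x) ≠ 0 := by
    rcases hN.unit x with h | h <;> simp [h]
  let L : E × ℝ →ₗ[ℝ] E' :=
    (show E →L[ℝ] E' from mfderiv I I' f x).toLinearMap.coprod
      (LinearMap.toSpanSingleton ℝ E' (N x))
  have hker (u : TangentSpace I x) (a : ℝ) (h : mfderiv I I' f x u + a • N x = 0) :
      u = 0 ∧ a = 0 := by
    have ha : a = 0 := by
      have := congrArg (g'.val (f x) (N x)) h
      rw [map_add, hN.normal, map_smul, map_zero, zero_add, smul_eq_mul] at this
      exact (mul_eq_zero.1 this).resolve_right hNN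
    subst ha
    exact ⟨hf.injective x (by rw [map_zero]; simpa using h), rfl⟩
  have hinj : Function.Injective L := by
    rw [← LinearMap.ker_eq_bot, LinearMap.ker_eq_bot']
    rintro ⟨u, a⟩ h
    exact Prod.ext (hker u a h).1 (hker u a h).2
  have hsurj := (LinearMap.injective_iff_surjective_of_finrank_eq_finrank
    (by rw [hdim, Module.finrank_prod, Module.finrank_self])).1 hinj
  obtain ⟨⟨u, a⟩, h⟩ := hsurj w
  exact ⟨u, a, h.symm⟩

theorem IsIsometricImmersion.val_sub_tangentialPart (hf : IsIsometricImmersion g g' f)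
    (hN : IsUnitNormalField I g' f N)
    (hdim : Module.finrank ℝ E' = Module.finrank ℝ E + 1) (x : M) (v w : TangentSpace I' (f x)) :
    g'.val (f x) (v - mfderiv I I' f x (tangentialPart g g' f x v)) w =
      g'.val (f x) (N x) (N x) * g'.val (f x) v (N x) * g'.val (f x) (N x) w := by
  obtain ⟨u, a, rfl⟩ := hf.exists_tangent_add_smul_normal hN hdim x w
  have h1 := (tangentialPart_eq_iff hf x v _).1 rfl u
  have h2 : g'.val (f x) (mfderiv I I' f x (tangentialPart g g' f x v)) (N x) = 0 := by
    rw [g'.symm, hN.normal]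
  rw [map_add, h1, map_add, hN.normal, map_smul, map_smul, map_sub, sub_apply, h2]
  rcases hN.unit x with h | h <;> simp [h] <;> ring

/-- The Weingarten operator represents the second fundamental form. -/
theorem IsIsometricImmersion.val_weingarten (hf : IsIsometricImmersion g g' f)
    (hN : IsUnitNormalField I g' f N) {x : M} {Z : Π x : M, TangentSpace I x}
    (hZ : MDiffAt (T% Z) x) (u : TangentSpace I x) :
    g.val x (weingarten g g' f N x u) (Z x) = g'.val (f x) (N x)
      (covDerivAlong I g'.leviCivita f (fun y ↦ mfderiv I I' f y (Z y)) x u) := by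
  have h := g'.mvfderiv_val_along ((hN.contMDiff x).mdifferentiableAt (by simp))
    (mdifferentiableAt_mfderiv_apply hf.contMDiff hZ) u
  simp only [hN.normal, mvfderiv_const] at h
  rw [weingarten, map_neg, neg_apply, val_tangentialPart]
  simp only [zero_apply] at h
  linarith

/-- The difference of the Lie derivatives of the ambient and of the induced metric, along a vector
field and along its tangential part. -/
theorem IsIsometricImmersion.lieDeriv_sub_lieDeriv [I.Boundaryless] [I'.Boundaryless]
    (hf : IsIsometricImmersion g g' f) (hN : IsUnitNormalField I g' f N)
    (hdim : Module.finrank ℝ E' = Module.finrank ℝ E + 1) {V' : Π y : M', TangentSpace I' y}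
    (hV' : ContMDiff I' I'.tangent ∞ (fun y ↦ (⟨y, V' y⟩ : TangentBundle I' M')))
    (x : M) (u w : TangentSpace I x) :
    g'.lieDeriv V' (f x) (mfderiv I I' f x u) (mfderiv I I' f x w)
        - g.lieDeriv (fun y ↦ tangentialPart g g' f y (V' (f y))) x u w =
      -2 * g'.val (f x) (N x) (N x) * g'.val (f x) (V' (f x)) (N x)
        * g.val x (weingarten g g' f N x u) w := by
  set V : Π x : M, TangentSpace I x := fun y ↦ tangentialPart g g' f y (V' (f y)) with hVdef
  have hV'd : MDiffAt (T% V') (f x) := (hV' (f x)).mdifferentiableAt (by simp)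
  have hfd : MDifferentiableAt I I' f x := (hf.contMDiff x).mdifferentiableAt (by simp)
  have hVf : ContMDiff I I'.tangent ∞ (fun y ↦ (⟨f y, V' (f y)⟩ : TangentBundle I' M')) :=
    hV'.comp hf.contMDiff
  have hVfd := (hVf x).mdifferentiableAt (by simp)
  have hV : MDiffAt (T% V) x :=
    (contMDiff_tangentialPart hf.contMDiff hVf x).mdifferentiableAt (by simp)
  have hdV := mdifferentiableAt_mfderiv_apply hf.contMDiff hV
  have hcomp (v : TangentSpace I x) : g'.leviCivita V' (f x) (mfderiv I I' f x v) =
      covDerivAlong I g'.leviCivita f (fun y ↦ V' (f y)) x v := by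
    rw [covDerivAlong_comp _ hfd hV'd]
    rfl
  have hu := mdifferentiableAt_extend I E u
  have hw := mdifferentiableAt_extend I E w
  have key (v : TangentSpace I x) {Z : Π x : M, TangentSpace I x} (hZ : MDiffAt (T% Z) x) :
      g'.val (f x) (covDerivAlong I g'.leviCivita f (fun y ↦ V' (f y)) x v)
          (mfderiv I I' f x (Z x))
        - g'.val (f x) (covDerivAlong I g'.leviCivita f (fun y ↦ mfderiv I I' f y (V y)) x v)
          (mfderiv I I' f x (Z x)) =
      - (g'.val (f x) (N x) (N x) * g'.val (f x) (V' (f x)) (N x) * g'.val (f x) (N x)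
          (covDerivAlong I g'.leviCivita f (fun y ↦ mfderiv I I' f y (Z y)) x v)) := by
    have hdZ := mdifferentiableAt_mfderiv_apply hf.contMDiff hZ
    have h1 := g'.mvfderiv_val_along hVfd hdZ v
    have h2 := g'.mvfderiv_val_along hdV hdZ v
    have h3 : (fun y ↦ g'.val (f y) (V' (f y)) (mfderiv I I' f y (Z y))) =
        fun y ↦ g'.val (f y) (mfderiv I I' f y (V y)) (mfderiv I I' f y (Z y)) := by
      ext y
      rw [hf.val_eq, val_tangentialPart]
    rw [h3, h2] at h1
    rw [← hf.val_sub_tangentialPart hN hdim, map_sub, sub_apply]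
    linarith
  have hsymm : g'.val (f x) (N x)
        (covDerivAlong I g'.leviCivita f (fun y ↦ mfderiv I I' f y (extend E w y)) x u) =
      g'.val (f x) (N x)
        (covDerivAlong I g'.leviCivita f (fun y ↦ mfderiv I I' f y (extend E u y)) x w) := by
    have h := congrArg (g'.val (f x) (N x)) (covDerivAlong_mfderiv_sub g' (hf.contMDiff x) hu hw)
    rw [hN.normal, map_sub, sub_eq_zero] at h
    simpa only [extend_apply_self] using h
  have hA := hf.val_weingarten hN hw u
  have k1 := key u hw
  have k2 := key w hu
  simp only [extend_apply_self] at hA k1 k2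
  rw [g'.lieDeriv_eq_leviCivita hV'd, hf.lieDeriv_eq hV, hcomp, hcomp, hA,
    g'.symm (f x) (mfderiv I I' f x u), g'.symm (f x) (mfderiv I I' f x u)]
  rw [← hsymm] at k2
  linarith

end AlongMap

end SemiRiemannianMetric

end

theorem lemma1 {n : ℕ}
    {M : Type*} [TopologicalSpace M] [ChartedSpace (EuclideanSpace ℝ (Fin n)) M]
    [IsManifold (𝓡 n) ∞ M]
    {M' : Type*} [TopologicalSpace M'] [ChartedSpace (EuclideanSpace ℝ (Fin (n + 1))) M']
    [IsManifold (𝓡 (n + 1)) ∞ M']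
    (g : SemiRiemannianMetric (𝓡 n) M) (g' : SemiRiemannianMetric (𝓡 (n + 1)) M')
    (f : M → M') (hf : g.IsIsometricImmersion g' f)
    (N : Π x : M, TangentSpace (𝓡 (n + 1)) (f x))
    (hN : SemiRiemannianMetric.IsUnitNormalField (𝓡 n) g' f N)
    (V' : Π y : M', TangentSpace (𝓡 (n + 1)) y)
    (hV' : ContMDiff (𝓡 (n + 1)) (𝓡 (n + 1)).tangent ∞
      (fun y ↦ (⟨y, V' y⟩ : TangentBundle (𝓡 (n + 1)) M'))) :
    let V : Π x : M, TangentSpace (𝓡 n) x := fun x ↦ g.tangentialPart g' f x (V' (f x))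
    let ε : M → ℝ := fun x ↦ g'.val (f x) (N x) (N x)
    let C : M → ℝ := fun x ↦ g'.val (f x) (V' (f x)) (N x)
    ContMDiff (𝓡 n) (𝓡 n).tangent ∞ (fun x ↦ (⟨x, V x⟩ : TangentBundle (𝓡 n) M)) ∧
    ∀ (x : M) (Y Z : TangentSpace (𝓡 n) x),
      g'.lieDeriv V' (f x) (mfderiv (𝓡 n) (𝓡 (n + 1)) f x Y) (mfderiv (𝓡 n) (𝓡 (n + 1)) f x Z)
          - g.lieDeriv V x Y Z
        = -2 * ε x * C x * g.val x (g.weingarten g' f N x Y) Z := by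
  have hVf : ContMDiff (𝓡 n) (𝓡 (n + 1)).tangent ∞
      (fun x ↦ (⟨f x, V' (f x)⟩ : TangentBundle (𝓡 (n + 1)) M')) := hV'.comp hf.contMDiff
  exact ⟨SemiRiemannianMetric.contMDiff_tangentialPart hf.contMDiff hVf,
    fun x Y Z ↦ hf.lieDeriv_sub_lieDeriv hN (by simp) hV' x Y Z⟩
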